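/- \textbf{Lemma (Core Lemma of MCM).} Let $\mathbb{K}$ be an algebraically closed field. For integers $N\geqslant 1$ and $m\geqslant 0$, let $\mathscr{M}_{m}^{N}\subset \mathsf{Mat}_{m\times 2(N+1)}(\mathbb{K})$ be the algebraic subvariety of all matrices $(\alpha_0\mid\cdots\mid\alpha_N\mid\beta_0\mid\cdots\mid\beta_N)$ such that: (1) $\alpha_0+\cdots+\alpha_N+\beta_0+\cdots+\beta_N=\mathbf{0}$; (2) for every $\nu=0,\dots,N$, $\operatorname{rank}\{\alpha_0,\dots,\widehat{\alpha_\nu},\dots,\alpha_N,\ \alpha_\nu+(\beta_0+\cdots+\beta_N)\}\leqslant N-1$; (3) for all $0\leqslant\tau<\rho\leqslant N$, $\operatorname{rank}\{\alpha_0+\beta_0,\dots,\alpha_\tau+\beta_\tau,\ \alpha_{\tau+1},\dots,\widehat{\alpha_\rho},\dots,\alpha_N,\ \alpha_\rho+(\beta_{\tau+1}+\cdots+\beta_N)\}\leqslant N-1$. Let $\mathbb{P}(\mathrm{T}_{\mathbb{P}^N})$ be the projectivized tangent bundle of $\mathbb{P}^N_{\mathbb{K}}$, whose points are the pairs $([z],[\xi])$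 with $[z]\in\mathbb{P}^N_{\mathbb{K}}$ and $[\xi]\in\mathbb{P}(\mathbb{K}^{N+1}/\mathbb{K}z)$. Let $\mathring{\mathbb{P}}(\mathrm{T}_{\mathbb{P}^N})$ be its part where all $z_i\neq 0$, and, for $0\leqslant v_1<\cdots<v_\eta\leqslant N$, let ${}_{v_1,\dots,v_\eta}\mathring{\mathbb{P}}(\mathrm{T}_{\mathbb{P}^N})$ be its part where $z_{v_1}=\cdots=z_{v_\eta}=0$ and all the other $z_i$ are nonzero. Dimension is Krull dimension for the Zariski topology, and the codimension of a nonempty subvariety $V$ of a matrix space is the dimension of that space minus $\dim V$. Let $N\geqslant 1$ and $c,r\geqslant 0$ be integers with $2c+r\geqslant N$. Then: (i) $\operatorname{codim}\mathscr{M}_{2c+r}^{N}\geqslant\dim\mathring{\mathbb{P}}(\mathrm{T}_{\mathbb{P}^N})=2N-1$; (ii) for every integer $\eta$ with $1\leqslant\eta\leqslant N-(c+r)-1$ and all indices $0\leqslant v_1<\cdots<v_\eta\leqslant N$, $$\operatorname{codim}\mathscr{M}_{2c+r}^{N-\eta}\geqslant\dim{}_{v_1,\dots,v_\eta}\mathring{\mathbb{P}}(\mathrm{T}_{\mathbb{P}^N})=2N-\eta-1.$$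 -/

import Mathlib

namespace MovingCoefficients

/-! ### Classical Zariski topology, Krull dimension, codimension -/

/-- The Zariski topology on the affine space `K^σ`: the closed sets are the zero loci of ideals of
polynomials. -/
def zariskiAffine (K σ : Type*) [Field K] : TopologicalSpace (σ → K) :=
  TopologicalSpace.ofClosed
    {Z | ∃ I : Ideal (MvPolynomial σ K), Z = MvPolynomial.zeroLocus K I}
    ⟨⊤, by simp⟩
    (by
      intro A hA
      refine ⟨sSup {I | MvPolynomial.zeroLocus K I ∈ A}, ?_⟩
      ext x
      have key : ∀ I : Ideal (MvPolynomial σ K),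
          x ∈ MvPolynomial.zeroLocus K I ↔ I ≤ MvPolynomial.vanishingIdeal K {x} := by
        intro I
        rw [← MvPolynomial.le_zeroLocus_iff_le_vanishingIdeal]
        simp
      rw [key, sSup_le_iff]
      constructor
      · intro hx I hI
        exact (key I).1 (hx _ hI)
      · intro hx Z hZ
        obtain ⟨I, rfl⟩ := hA hZ
        exact (key I).2 (hx I hZ))
    (by
      rintro _ ⟨I, rfl⟩ _ ⟨J, rfl⟩
      refine ⟨I * J, ?_⟩
      ext x
      have key : ∀ I : Ideal (MvPolynomial σ K),
          x ∈ MvPolynomial.zeroLocus K I ↔ I ≤ MvPolynomial.vanishingIdeal K {x} := by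
        intro I
        rw [← MvPolynomial.le_zeroLocus_iff_le_vanishingIdeal]
        simp
      rw [Set.mem_union, key, key, key, Ideal.IsPrime.mul_le inferInstance])

/-- The Krull dimension of a subset `V` of a space `X` with topology `t`, i.e. the supremum of the
lengths of chains of irreducible closed subsets of `V` (for the induced topology). -/
noncomputable def dimOn {X : Type*} (t : TopologicalSpace X) (V : Set X) : WithBot ℕ∞ :=
  @topologicalKrullDim V (t.induced Subtype.val)

/-- The Zariski topology on the affine space `Mat_{m × n}(K)`, whose coordinates are the entries. -/
def zariskiMatrix (K m n : Type*) [Field K] : TopologicalSpace (Matrix m n K) :=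
  (zariskiAffine K (m × n)).induced fun A p => A p.1 p.2

/-- The codimension `dim Mat_{m × n}(K) - dim V` of a (nonempty) subset `V` of a space of
matrices. -/
noncomputable def codimMatrix {K m n : Type*} [Field K] (V : Set (Matrix m n K)) : ℕ∞ :=
  (dimOn (zariskiMatrix K m n) Set.univ).unbotD 0 - (dimOn (zariskiMatrix K m n) V).unbotD 0

/-! ### The matrix varieties -/

/-- The rank of a family of vectors. -/
noncomputable def familyRank (K : Type*) {ι W : Type*} [Field K] [AddCommGroup W] [Module K W]
    (v : ι → W) : ℕ :=
  Module.finrank K (Submodule.span K (Set.range v))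

/-- The variety of `m × 2(N+1)` matrices `(α_0 | ⋯ | α_N | β_0 | ⋯ | β_N)` such that the sum of all
the columns is zero and such that all the families
`{α_0, …, α̂_ν, …, α_N, α_ν + (β_0 + ⋯ + β_N)}` for `0 ≤ ν ≤ N` and
`{α_0 + β_0, …, α_τ + β_τ, α_{τ+1}, …, α̂_ρ, …, α_N, α_ρ + (β_{τ+1} + ⋯ + β_N)}` for
`0 ≤ τ < ρ ≤ N` have rank at most `N - 1`. The columns `α_j`, `β_j` are indexed by `Sum.inl j` and
`Sum.inr j`. -/
def coreVariety (K : Type*) [Field K] (m N : ℕ) :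
    Set (Matrix (Fin m) (Fin (N + 1) ⊕ Fin (N + 1)) K) :=
  {A | let α : Fin (N + 1) → (Fin m → K) := fun j i => A i (Sum.inl j)
       let β : Fin (N + 1) → (Fin m → K) := fun j i => A i (Sum.inr j)
       (∑ j, α j) + (∑ j, β j) = 0 ∧
       (∀ ν : Fin (N + 1),
          familyRank K (fun j => if j = ν then α ν + ∑ k, β k else α j) + 1 ≤ N) ∧
       (∀ τ ρ : Fin (N + 1), τ < ρ →
          familyRank K (fun j =>
            if j ≤ τ then α j + β j
            else if j = ρ then α ρ + ∑ k ∈ Finset.Ioi τ, β k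
            else α j) + 1 ≤ N)}

/-! ### The projectivized tangent bundle of projective space -/

/-- The points `([z], [ξ])` of `ℙ(T_{ℙ^N})`: a point `[z]` of `ℙ^N` and a point `[ξ]` of the
projectivization of the tangent space `K^{N+1} / K·z`. -/
abbrev ProjTangent (K : Type*) [Field K] (N : ℕ) : Type _ :=
  Σ x : Projectivization K (Fin (N + 1) → K),
    Projectivization K ((Fin (N + 1) → K) ⧸ x.submodule)

/-- The pairs `(z, ξ)` with `z ≠ 0` and `ξ ∉ K·z`. -/
abbrev TangentPair (K : Type*) [Field K] (N : ℕ) : Type _ :=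
  {p : (Fin (N + 1) → K) × (Fin (N + 1) → K) // p.1 ≠ 0 ∧ p.2 ∉ Submodule.span K {p.1}}

/-- The canonical projection `(z, ξ) ↦ ([z], [ξ])`. -/
def tangentProj (K : Type*) [Field K] (N : ℕ) (p : TangentPair K N) : ProjTangent K N :=
  ⟨Projectivization.mk K p.1.1 p.2.1,
    Projectivization.mk K (Submodule.Quotient.mk p.1.2) (by
      rw [Ne, Submodule.Quotient.mk_eq_zero, Projectivization.submodule_mk]
      exact p.2.2)⟩

/-- The Zariski topology on `ℙ(T_{ℙ^N})`: the quotient of the Zariski topology on the space of pairs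
`(z, ξ)`, a subspace of the affine space `K^{2(N+1)}`. -/
def zariskiProjTangent (K : Type*) [Field K] (N : ℕ) : TopologicalSpace (ProjTangent K N) :=
  ((zariskiAffine K (Fin (N + 1) ⊕ Fin (N + 1))).induced
    fun p : TangentPair K N => Sum.elim p.1.1 p.1.2).coinduced (tangentProj K N)

/-- The part of `ℙ(T_{ℙ^N})` where `z_i = 0` for `i ∈ S` and `z_i ≠ 0` for `i ∉ S`. -/
def coordinateStratum (K : Type*) [Field K] (N : ℕ) (S : Set (Fin (N + 1))) :
    Set (ProjTangent K N) :=
  {p | ∀ i, p.1.rep i = 0 ↔ i ∈ S}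

/-- The dimension of the part of `ℙ(T_{ℙ^N})` where exactly the coordinates `z_i` with `i ∈ S`
vanish. -/
noncomputable def dimStratum (K : Type*) [Field K] (N : ℕ) (S : Set (Fin (N + 1))) :
    WithBot ℕ∞ :=
  dimOn (zariskiProjTangent K N) (coordinateStratum K N S)

end MovingCoefficients

namespace MovingCoefficients

open MvPolynomial Topology

/-! ### Dimension of subsets of affine space -/

/-! Write `m = 2c + r` for the number of rows. The matrix varieties lie in zero loci of homogeneous
polynomials, and a cone that meets a linear subspace of dimension `d` only at the origin has
codimension at least `d`. It therefore suffices to exhibit a subspace of dimension `2m + 1` with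
this property, whenever `1 ≤ N ≤ m`.

Two kinds of equations are enough: the row sums vanish, and for each `κ` the `N` columns `α_j + β_j`
(`j < κ`), `α_j` (`j > κ`) are dependent. These columns never involve `β_N`, so `β_N` can be used to
prescribe all row sums, which gives `m` parameters. The other columns are filled with shifted bands
of `m + 1` parameters `t_0, …, t_m`. If `t_k` is the first nonzero one, then for `κ = min k N` the
lowest nonzero entries of the `N` columns all equal `t_k` and lie in distinct rows, so some minor is
triangular and nonzero (`exists_minor_ne_zero`).

The strata are computed with affine charts: `z_i = 1`, `ξ_i = 0`, `ξ_j = 1` leaves `2N - |S| - 1`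
free coordinates (`dimStratum_eq`). As `m ≥ N`, the bound `2m + 1` exceeds all these dimensions, for
`N` and for every `N - η ≥ 1`. -/

theorem ringKrullDim_le_of_isIntegral {R S : Type*} [CommRing R] [CommRing S] [Algebra R S]
    [Algebra.IsIntegral R S] : ringKrullDim S ≤ ringKrullDim R :=
  Order.krullDim_le_of_strictMono (PrimeSpectrum.comap (algebraMap R S)) fun p q h =>
    Ideal.IsIntegral.comap_lt_comap (R := R) (I := p.asIdeal) (J := q.asIdeal) h

theorem isClosed_zariskiAffine {K σ : Type*} [Field K] {Z : Set (σ → K)} :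
    IsClosed[zariskiAffine K σ] Z ↔
      ∃ I : Ideal (MvPolynomial σ K), Z = MvPolynomial.zeroLocus K I := by
  rw [← @isOpen_compl_iff _ _ (zariskiAffine K σ)]
  change Zᶜᶜ ∈ _ ↔ _
  rw [compl_compl]
  rfl

theorem dimOn_mono {X : Type*} {t : TopologicalSpace X} {V W : Set X} (h : V ⊆ W) :
    dimOn t V ≤ dimOn t W :=
  @Topology.IsInducing.topologicalKrullDim_le W V (t.induced _) (t.induced _) (Set.inclusion h)
    (@Topology.IsInducing.mk _ _ (_) (_) _ (by rw [induced_compose]; rfl))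

/-- A point is sent to the kernel of its evaluation map. Closed sets on both sides are given by
vanishing of polynomials, so `V` carries the topology induced from the spectrum. -/
theorem dimOn_le_ringKrullDim {K σ : Type*} [Field K] {V : Set (σ → K)}
    {I : Ideal (MvPolynomial σ K)} (h : V ⊆ zeroLocus K I) :
    dimOn (zariskiAffine K σ) V ≤ ringKrullDim (MvPolynomial σ K ⧸ I) := by
  let _ := zariskiAffine K σ
  let ev (x : V) : MvPolynomial σ K ⧸ I →+* K :=
    Ideal.Quotient.lift I (aeval (R := K) x.1).toRingHom fun p hp => h x.2 p hp
  let f (x : V) : PrimeSpectrum (MvPolynomial σ K ⧸ I) := ⟨RingHom.ker (ev x), RingHom.ker_isPrime _⟩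
  have hf : IsInducing f := by
    rw [isInducing_iff]
    refine TopologicalSpace.ext_isClosed fun Z => ?_
    have h1 : IsClosed Z ↔ ∃ J : Ideal (MvPolynomial σ K), Subtype.val ⁻¹' zeroLocus K J = Z := by
      rw [isClosed_induced_iff]
      simp only [isClosed_zariskiAffine]
      constructor
      · rintro ⟨_, ⟨J, rfl⟩, rfl⟩; exact ⟨J, rfl⟩
      · rintro ⟨J, rfl⟩; exact ⟨_, ⟨J, rfl⟩, rfl⟩
    rw [h1, isClosed_induced_iff]
    constructor
    · rintro ⟨J, rfl⟩
      refine ⟨PrimeSpectrum.zeroLocus (Ideal.Quotient.mk I '' J), PrimeSpectrum.isClosed_zeroLocus _, ?_⟩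
      ext x
      simp only [Set.mem_preimage, PrimeSpectrum.mem_zeroLocus, Set.image_subset_iff,
        mem_zeroLocus_iff]
      exact Iff.rfl
    · rintro ⟨T, hT, rfl⟩
      obtain ⟨s, rfl⟩ := (PrimeSpectrum.isClosed_iff_zeroLocus _).1 hT
      refine ⟨Ideal.span (Ideal.Quotient.mk I ⁻¹' s), ?_⟩
      ext x
      simp only [Set.mem_preimage, zeroLocus_span, PrimeSpectrum.mem_zeroLocus]
      constructor
      · intro hx p hp
        obtain ⟨p, rfl⟩ := Ideal.Quotient.mk_surjective p
        exact hx p hp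
      · intro hx p hp
        exact hx hp
  have := hf.topologicalKrullDim_le
  rwa [PrimeSpectrum.topologicalKrullDim_eq_ringKrullDim] at this

theorem dimOn_affine_le {K σ : Type*} [Field K] [Fintype σ] (V : Set (σ → K)) :
    dimOn (zariskiAffine K σ) V ≤ Fintype.card σ := by
  have h := dimOn_le_ringKrullDim (V := V) (I := ⊥) (by simp)
  rwa [ringKrullDim_eq_of_ringEquiv (RingEquiv.quotientBot _),
    MvPolynomial.ringKrullDim_of_isNoetherianRing, ringKrullDim_eq_zero_of_field, zero_add,
    Nat.card_eq_fintype_card] at h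

/-! ### Irreducibility and lower bounds -/

theorem continuous_zariskiAffine {K σ τ : Type*} [Field K] (g : σ → MvPolynomial τ K) :
    Continuous[zariskiAffine K τ, zariskiAffine K σ] fun x s => eval x (g s) := by
  let _ := zariskiAffine K σ
  let _ := zariskiAffine K τ
  refine continuous_iff_isClosed.2 fun Z hZ => ?_
  obtain ⟨I, rfl⟩ := isClosed_zariskiAffine.1 hZ
  refine isClosed_zariskiAffine.2 ⟨I.map (aeval g).toRingHom, ?_⟩
  rw [Ideal.map, zeroLocus_span]
  ext x
  simp only [Set.mem_preimage, mem_zeroLocus_iff, Set.mem_ofPred_eq, Set.forall_mem_image]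
  refine forall₂_congr fun p _ => ?_
  have : aeval (R := K) (fun s => eval x (g s)) p = aeval x (aeval g p) := by
    clear * -
    induction p using MvPolynomial.induction_on <;> simp_all
  rw [this]
  rfl

theorem isOpen_zariskiAffine_ne {K σ : Type*} [Field K] (f : MvPolynomial σ K) :
    IsOpen[zariskiAffine K σ] {x | eval x f ≠ 0} := by
  let _ := zariskiAffine K σ
  rw [← isClosed_compl_iff]
  refine isClosed_zariskiAffine.2 ⟨Ideal.span {f}, ?_⟩
  ext x
  simp [zeroLocus_span]

theorem exists_eval_ne_zero_of_isOpen {K σ : Type*} [Field K] {U : Set (σ → K)}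
    (hU : IsOpen[zariskiAffine K σ] U) {x : σ → K} (hx : x ∈ U) :
    ∃ f : MvPolynomial σ K, eval x f ≠ 0 ∧ ∀ y, eval y f ≠ 0 → y ∈ U := by
  let _ := zariskiAffine K σ
  obtain ⟨I, hI⟩ := isClosed_zariskiAffine.1 (isClosed_compl_iff.2 hU)
  have hmem : ∀ y, y ∈ U ↔ ∃ p ∈ I, eval y p ≠ 0 := by
    intro y
    rw [← not_iff_not, ← Set.mem_compl_iff, hI]
    simp only [mem_zeroLocus_iff, not_exists, not_and, not_not]
    rfl
  obtain ⟨p, hp, hpx⟩ := (hmem x).1 hx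
  exact ⟨p, hpx, fun y hy => (hmem y).2 ⟨p, hp, hy⟩⟩

theorem preirreducibleSpace_zariskiAffine (K σ : Type*) [Field K] [Infinite K] :
    @PreirreducibleSpace (σ → K) (zariskiAffine K σ) := by
  let _ := zariskiAffine K σ
  refine ⟨fun U V hU hV ⟨x, _, hx⟩ ⟨y, _, hy⟩ => ?_⟩
  obtain ⟨f, hf, hfU⟩ := exists_eval_ne_zero_of_isOpen hU hx
  obtain ⟨g, hg, hgV⟩ := exists_eval_ne_zero_of_isOpen hV hy
  have hfg : f * g ≠ 0 := by
    apply mul_ne_zero <;> rintro rfl <;> simp_all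
  obtain ⟨z, hz⟩ : ∃ z, eval z (f * g) ≠ 0 := by
    by_contra! H
    exact hfg (MvPolynomial.funext fun z => by simpa using H z)
  rw [map_mul] at hz
  exact ⟨z, trivial, hfU z (left_ne_zero_of_mul hz), hgV z (right_ne_zero_of_mul hz)⟩

/-- A full flag of coordinate subspaces through a point of `U` stays a strict chain of irreducible
closed sets after intersection with `U`. -/
theorem card_le_dimOn_of_isOpen {K σ : Type*} [Field K] [Infinite K] [Fintype σ]
    {U : Set (σ → K)} (hU : IsOpen[zariskiAffine K σ] U) (hne : U.Nonempty) :
    (Fintype.card σ : WithBot ℕ∞) ≤ dimOn (zariskiAffine K σ) U := by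
  let _ := zariskiAffine K σ
  have := preirreducibleSpace_zariskiAffine K σ
  classical
  obtain ⟨p, hp⟩ := hne
  let e := Fintype.equivFin σ
  let L (i : ℕ) : Set (σ → K) := {x | ∀ k, i ≤ e k → x k = p k}
  have hLirr : ∀ i, IsPreirreducible (L i) := by
    intro i
    have hc := continuous_zariskiAffine (K := K)
      (fun k : σ => if i ≤ (e k : ℕ) then C (p k) else X k)
    have := (PreirreducibleSpace.isPreirreducible_univ (X := σ → K)).image _ hc.continuousOn
    convert this using 1
    ext x
    simp only [Set.image_univ, Set.mem_range, L, Set.mem_ofPred_eq]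
    constructor
    · intro hx
      refine ⟨x, funext fun k => ?_⟩
      split_ifs with h
      · simp [hx k h]
      · simp
    · rintro ⟨y, rfl⟩ k hk
      simp [hk]
  have hLcl : ∀ i, IsClosed (L i) := by
    intro i
    have : L i = ⋂ k, {x | eval x (if i ≤ (e k : ℕ) then X k - C (p k) else 0) ≠ 0}ᶜ := by
      ext x
      simp only [L, Set.mem_ofPred_eq, Set.mem_iInter, Set.mem_compl_iff, not_not]
      refine forall_congr' fun k => ?_
      split_ifs with h <;> simp [h, sub_eq_zero]
    rw [this]
    exact isClosed_iInter fun k => (isOpen_zariskiAffine_ne _).isClosed_compl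
  have hpL : ∀ i, p ∈ L i := fun i k _ => rfl
  let Z (i : ℕ) : TopologicalSpace.IrreducibleCloseds U :=
    { carrier := Subtype.val ⁻¹' L i
      isIrreducible' := ⟨⟨⟨p, hp⟩, hpL i⟩,
        (hLirr i).preimage hU.isOpenEmbedding_subtypeVal⟩
      isClosed' := (hLcl i).preimage continuous_subtype_val }
  have hZ : ∀ i, i < Fintype.card σ → Z i < Z (i + 1) := by
    intro i hi
    refine lt_of_le_not_ge (fun x hx k hk => hx k (by omega)) fun hle => ?_
    let k := e.symm ⟨i, hi⟩
    -- By irreducibility of `L (i + 1)`, its two nonempty open parts, inside `U` and off `x k = p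
    -- k`, share a point.
    obtain ⟨x, hxL, hxU, hx⟩ := hLirr (i + 1) U {x | eval x (X k - C (p k)) ≠ 0} hU
      (isOpen_zariskiAffine_ne _) ⟨p, hpL _, hp⟩
      ⟨Function.update p k (p k + 1), by
        intro l hl
        rw [Function.update_of_ne]
        rintro rfl
        simp [k] at hl, by simp⟩
    have hxk : x k = p k := hle (show (⟨x, hxU⟩ : U) ∈ Z (i + 1) from hxL) k (by simp [k])
    simp [hxk] at hx
  let s : LTSeries (TopologicalSpace.IrreducibleCloseds U) :=
    { length := Fintype.card σ
      toFun := fun i => Z i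
      step := fun i => hZ i i.2 }
  exact Order.LTSeries.length_le_krullDim s

/-! ### Cones meeting a linear subspace only at the origin -/

section Cone

variable {K σ : Type*} [Field K]

attribute [local instance] MvPolynomial.gradedAlgebra

theorem decompose_mul_linear (f p : MvPolynomial σ K) (hp : p.IsHomogeneous 1) (e : ℕ) :
    (DirectSum.decompose (homogeneousSubmodule σ K) (f * p) (e + 1) : MvPolynomial σ K) =
      (DirectSum.decompose (homogeneousSubmodule σ K) f e : MvPolynomial σ K) * p := by
  rw [DirectSum.coe_decompose_mul_of_right_mem_of_le (homogeneousSubmodule σ K)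
    ((mem_homogeneousSubmodule 1 p).2 hp) (Nat.le_add_left 1 e), Nat.add_sub_cancel]

/-- If `X_i ^ (e + 1)` lies in the ideal generated by a homogeneous ideal `I` and linear forms
`P_j`, then the coefficients of the `P_j` may be taken homogeneous of degree `e`. -/
theorem exists_homogeneous_coeff {κ : Type*} [Fintype κ] {I : Ideal (MvPolynomial σ K)}
    (hI : I.IsHomogeneous (homogeneousSubmodule σ K)) {P : κ → MvPolynomial σ K}
    (hP : ∀ j, (P j).IsHomogeneous 1) {i : σ} {e : ℕ}
    (h : (X i : MvPolynomial σ K) ^ (e + 1) ∈ I ⊔ Ideal.span (Set.range P)) :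
    ∃ g : κ → MvPolynomial σ K, (∀ j, (g j).IsHomogeneous e) ∧
      (X i : MvPolynomial σ K) ^ (e + 1) - ∑ j, g j * P j ∈ I := by
  obtain ⟨f, hf, q, hq, hfq⟩ := Submodule.mem_sup.1 h
  obtain ⟨c, rfl⟩ := Ideal.mem_span_range_iff_exists_fun.1 hq
  refine ⟨fun j => (DirectSum.decompose (homogeneousSubmodule σ K) (c j) e : MvPolynomial σ K),
    fun j => (mem_homogeneousSubmodule _ _).1 (SetLike.coe_mem _), ?_⟩
  -- The component of degree `e + 1` of an element of `I` is again in `I`; on `c j * P j` it picks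
  -- out the degree `e` part of `c j`.
  have h1 := hI (e + 1) hf
  have h2 : f = X i ^ (e + 1) - ∑ j, c j * P j := by rw [← hfq]; ring
  have h3 : ((X i : MvPolynomial σ K) ^ (e + 1)) ∈ homogeneousSubmodule σ K (e + 1) := by
    rw [mem_homogeneousSubmodule]
    simpa using (isHomogeneous_X K i).pow (e + 1)
  rw [h2, DirectSum.decompose_sub, DirectSum.sub_apply, DirectSum.decompose_sum,
    AddSubgroupClass.coe_sub, DirectSum.decompose_of_mem_same _ h3, DFinsupp.finsetSum_apply,
    AddSubmonoidClass.coe_finsetSum] at h1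
  simpa only [decompose_mul_linear _ _ (hP _)] using h1

theorem ringKrullDim_le_of_finite {R S : Type*} [CommRing R] [CommRing S] {φ : R →+* S}
    (h : φ.Finite) : ringKrullDim S ≤ ringKrullDim R := by
  algebraize [φ]
  exact ringKrullDim_le_of_isIntegral

/-- Each relation trades `X_i ^ (e + 1)` for coefficients from `κ` times polynomials of degree one
less. Induction on the degree leaves only monomials of bounded degree as module generators. -/
theorem finite_of_monomial_relations [Fintype σ] {κ Q : Type*} [Fintype κ] [CommRing Q]
    {π : MvPolynomial σ K →+* Q} (hπ : Function.Surjective π) (φ : MvPolynomial κ K →+* Q)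
    (hC : ∀ c, π (C c) = φ (C c)) {e : ℕ} {g : σ → κ → MvPolynomial σ K}
    (hg : ∀ i j, (g i j).IsHomogeneous e)
    (hrel : ∀ i, π (X i ^ (e + 1)) = ∑ j, φ (X j) * π (g i j)) : φ.Finite := by
  classical
  let _ : Algebra (MvPolynomial κ K) Q := φ.toAlgebra
  have hsmul : ∀ (r : MvPolynomial κ K) (x : Q), r • x = φ r * x := fun r x => rfl
  let mon (a : σ →₀ ℕ) : Q := π (monomial a 1)
  -- Beyond this degree some exponent is at least `e + 1`, by pigeonhole.
  let B : Set (σ →₀ ℕ) := {a | a.degree < Fintype.card σ * (e + 1) + 1}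
  let S : Submodule (MvPolynomial κ K) Q := Submodule.span _ (mon '' B)
  have hcomb : ∀ q : MvPolynomial σ K, (∀ b ∈ q.support, mon b ∈ S) → π q ∈ S := by
    intro q hq
    rw [q.as_sum, map_sum]
    refine Submodule.sum_mem _ fun b hb => ?_
    have : π (monomial b (coeff b q)) = (C (coeff b q) : MvPolynomial κ K) • mon b := by
      rw [hsmul, ← mul_one (coeff b q), ← C_mul_monomial, map_mul, mul_one, hC]
    rw [this]
    exact S.smul_mem _ (hq b hb)
  have hmon : ∀ s : ℕ, ∀ a : σ →₀ ℕ, a.degree = s → mon a ∈ S := by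
    intro s
    induction s using Nat.strong_induction_on with
    | _ s ih =>
      intro a ha
      by_cases haB : a ∈ B
      · exact Submodule.subset_span ⟨a, haB, rfl⟩
      obtain ⟨i, hi⟩ : ∃ i, e + 1 ≤ a i := by
        by_contra! H
        apply haB
        have : a.degree ≤ ∑ _i : σ, (e + 1) := by
          rw [Finsupp.degree_eq_sum]
          exact Finset.sum_le_sum fun i _ => (H i).le
        simp at this
        simp only [B, Set.mem_ofPred_eq]
        omega
      let a' := a - Finsupp.single i (e + 1)
      have haa : a' + Finsupp.single i (e + 1) = a :=
        tsub_add_cancel_of_le (Finsupp.single_le_iff.2 hi)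
      have hdeg : a'.degree + (e + 1) = s := by
        rw [← ha, ← haa, map_add, Finsupp.degree_single]
      have h1 : mon a = ∑ j, (X j : MvPolynomial κ K) • π (monomial a' 1 * g i j) := by
        have h3 : mon a = π (monomial a' 1) * π (X i ^ (e + 1)) := by
          rw [← map_mul, X_pow_eq_monomial, monomial_mul, haa, mul_one]
        rw [h3, hrel, Finset.mul_sum]
        refine Finset.sum_congr rfl fun j _ => ?_
        rw [hsmul, map_mul]
        ring
      rw [h1]
      refine Submodule.sum_mem _ fun j _ => S.smul_mem _ (hcomb _ fun b hb => ?_)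
      have hhom : (monomial a' (1 : K) * g i j).IsHomogeneous (a'.degree + e) :=
        (isHomogeneous_monomial _ rfl).mul (hg i j)
      have hb' : b.degree = a'.degree + e := by
        by_contra hne
        exact (mem_support_iff.1 hb) (hhom.coeff_eq_zero hne)
      exact ih _ (by omega) b hb'
  refine ⟨Submodule.fg_def.2 ⟨mon '' B, (Finsupp.finite_of_degree_lt _).image _, ?_⟩⟩
  refine eq_top_iff.2 fun x _ => ?_
  obtain ⟨q, rfl⟩ := hπ x
  exact hcomb q fun b _ => hmon _ b rfl

/-- By the Nullstellensatz the variables are nilpotent modulo `I` and the `P_j`. By homogeneity this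
makes the quotient by `I` finite over the polynomial ring in the `P_j`. -/
theorem ringKrullDim_quotient_le_of_linear_forms [IsAlgClosed K] [Fintype σ] {κ : Type*}
    [Fintype κ] {I : Ideal (MvPolynomial σ K)}
    (hI : I.IsHomogeneous (homogeneousSubmodule σ K)) {P : κ → MvPolynomial σ K}
    (hP : ∀ j, (P j).IsHomogeneous 1)
    (h : ∀ x ∈ zeroLocus K I, (∀ j, eval x (P j) = 0) → x = 0) :
    ringKrullDim (MvPolynomial σ K ⧸ I) ≤ Fintype.card κ := by
  classical
  obtain ⟨e, he⟩ : ∃ e : ℕ, ∀ i : σ, (X i : MvPolynomial σ K) ^ (e + 1) ∈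
      I ⊔ Ideal.span (Set.range P) := by
    have hX : ∀ i : σ, ∃ e : ℕ, (X i : MvPolynomial σ K) ^ e ∈ I ⊔ Ideal.span (Set.range P) := by
      intro i
      have : (X i : MvPolynomial σ K) ∈ (I ⊔ Ideal.span (Set.range P)).radical := by
        rw [← vanishingIdeal_zeroLocus_eq_radical (K := K), mem_vanishingIdeal_iff]
        intro x hx
        have hx0 : x = 0 := h x (fun p hp => hx p (Ideal.mem_sup_left hp)) fun j =>
          hx _ (Ideal.mem_sup_right (Ideal.subset_span ⟨j, rfl⟩))
        simp [hx0]
      exact this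
    choose e he using hX
    refine ⟨∑ i, e i, fun i => Ideal.pow_mem_of_pow_mem _ (he i) ?_⟩
    exact (Finset.single_le_sum (fun i _ => Nat.zero_le (e i)) (Finset.mem_univ i)).trans
      (Nat.le_succ _)
  choose g hg hgI using fun i => exists_homogeneous_coeff hI hP (he i)
  let φ : MvPolynomial κ K →+* MvPolynomial σ K ⧸ I :=
    (Ideal.Quotient.mk I).comp (aeval P).toRingHom
  have hfin : φ.Finite := by
    refine finite_of_monomial_relations Ideal.Quotient.mk_surjective φ (fun c => ?_) hg fun i => ?_
    · simp [φ, algebraMap_eq]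
    · have h2 := hgI i
      rw [← Ideal.Quotient.eq_zero_iff_mem, map_sub, sub_eq_zero, map_sum] at h2
      rw [h2]
      refine Finset.sum_congr rfl fun j _ => ?_
      rw [map_mul, mul_comm]
      simp [φ]
  have := ringKrullDim_le_of_finite hfin
  rwa [MvPolynomial.ringKrullDim_of_isNoetherianRing, ringKrullDim_eq_zero_of_field, zero_add,
    Nat.card_eq_fintype_card] at this

/-- If a linear subspace, parametrized by `ψ`, meets the cone over `V` only at the origin, then its
dimension is at most the codimension of `V`. -/
theorem dimOn_le_of_linear_section [IsAlgClosed K] [Fintype σ] {ι : Type*} [Fintype ι]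
    {V : Set (σ → K)} (h0 : 0 ∈ V) (ψ : (ι → K) →ₗ[K] (σ → K))
    (hψ : ∀ u, u ≠ 0 → ∃ (f : MvPolynomial σ K) (d : ℕ), f.IsHomogeneous d ∧
      (∀ x ∈ V, eval x f = 0) ∧ eval (ψ u) f ≠ 0) :
    dimOn (zariskiAffine K σ) V ≤ ((Fintype.card σ - Fintype.card ι : ℕ) : WithBot ℕ∞) := by
  classical
  let F : Set (MvPolynomial σ K) := {f | (∃ d, f.IsHomogeneous d) ∧ ∀ x ∈ V, eval x f = 0}
  have hI : (Ideal.span F).IsHomogeneous (homogeneousSubmodule σ K) :=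
    Ideal.homogeneous_span _ _ fun f ⟨⟨d, hd⟩, _⟩ => ⟨d, hd⟩
  have hV : V ⊆ zeroLocus K (Ideal.span F) := by
    rw [zeroLocus_span]
    exact fun x hx f hf => hf.2 x hx
  have hZ : ∀ u, ψ u ∈ zeroLocus K (Ideal.span F) → u = 0 := by
    intro u hu
    by_contra hne
    obtain ⟨f, d, hd, hf, hfu⟩ := hψ u hne
    exact hfu (hu f (Ideal.subset_span ⟨⟨d, hd⟩, hf⟩))
  have hinj : Function.Injective ψ := by
    refine (injective_iff_map_eq_zero ψ).2 fun u hu => hZ u ?_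
    rw [hu]
    exact hV h0
  have hcard : Module.finrank K ((σ → K) ⧸ LinearMap.range ψ) =
      Fintype.card σ - Fintype.card ι := by
    have h1 := Submodule.finrank_quotient_add_finrank (LinearMap.range ψ)
    rw [LinearMap.finrank_range_of_inj hinj, Module.finrank_fintype_fun_eq_card,
      Module.finrank_fintype_fun_eq_card] at h1
    omega
  -- Coordinates on the quotient by the range of `ψ` are the linear forms that cut out this range.
  let b := Module.finBasisOfFinrankEq K ((σ → K) ⧸ LinearMap.range ψ) hcard
  let ℓ (j : Fin (Fintype.card σ - Fintype.card ι)) : (σ → K) →ₗ[K] K :=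
    b.coord j ∘ₗ (LinearMap.range ψ).mkQ
  let P (j : Fin (Fintype.card σ - Fintype.card ι)) : MvPolynomial σ K :=
    ∑ i, C (ℓ j (Pi.single i 1)) * X i
  have hPeval : ∀ x j, eval x (P j) = ℓ j x := by
    intro x j
    conv_rhs => rw [LinearMap.pi_apply_eq_sum_univ (ℓ j) x]
    simp only [P, map_sum, map_mul, eval_C, eval_X, smul_eq_mul]
    refine Finset.sum_congr rfl fun i _ => ?_
    rw [mul_comm]
    congr 2
    ext k
    simp [Pi.single_apply, eq_comm]
  have hP : ∀ j, (P j).IsHomogeneous 1 := fun j =>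
    IsHomogeneous.sum _ _ _ fun i _ => (isHomogeneous_X K i).C_mul _
  refine (dimOn_le_ringKrullDim hV).trans ?_
  have := ringKrullDim_quotient_le_of_linear_forms hI hP fun x hx hxP => ?_
  · simpa using this
  · have hx0 : (LinearMap.range ψ).mkQ x = 0 := by
      refine b.ext_elem fun j => ?_
      have := hxP j
      rw [hPeval] at this
      simpa [ℓ] using this
    rw [Submodule.mkQ_apply, Submodule.Quotient.mk_eq_zero] at hx0
    obtain ⟨u, rfl⟩ := hx0
    rw [hZ u hx, map_zero]

end Cone

/-! ### Dimension in spaces of matrices -/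

theorem dimOn_induced_le {X Y : Type*} {t : TopologicalSpace Y} {f : X → Y} {V : Set X}
    {W : Set Y} (h : Set.MapsTo f V W) : dimOn (t.induced f) V ≤ dimOn t W :=
  @Topology.IsInducing.topologicalKrullDim_le W V (t.induced _) ((t.induced f).induced _)
    (Set.MapsTo.restrict f V W h)
    (@Topology.IsInducing.mk _ _ (_) (_) _ (by rw [induced_compose, induced_compose]; rfl))

theorem dimOn_zariskiMatrix_le {K m n : Type*} [Field K] (V : Set (Matrix m n K)) :
    dimOn (zariskiMatrix K m n) V ≤
      dimOn (zariskiAffine K (m × n)) {x | Matrix.of (fun i j => x (i, j)) ∈ V} :=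
  dimOn_induced_le fun _ hA => hA

theorem card_le_dimOn_zariskiMatrix (K m n : Type*) [Field K] [Infinite K] [Fintype m]
    [Fintype n] : (Fintype.card (m × n) : WithBot ℕ∞) ≤
      dimOn (zariskiMatrix K m n) Set.univ := by
  have h1 : zariskiAffine K (m × n) =
      (zariskiMatrix K m n).induced fun x => Matrix.of fun i j => x (i, j) := by
    rw [zariskiMatrix, induced_compose]
    exact (@induced_id _ (zariskiAffine K (m × n))).symm
  refine (card_le_dimOn_of_isOpen (U := Set.univ)
    (@isOpen_univ _ (zariskiAffine K (m × n))) ⟨0, trivial⟩).trans ?_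
  rw [h1]
  exact dimOn_induced_le fun _ _ => trivial

/-- A difference is bounded below by a lower bound for the ambient dimension and an upper bound for
`dim V`; `hd` keeps the truncated subtraction exact. -/
theorem le_codimMatrix {K m n : Type*} [Field K] [Infinite K] [Fintype m] [Fintype n]
    {V : Set (Matrix m n K)} {d : ℕ} (hd : d ≤ Fintype.card (m × n))
    (hV : dimOn (zariskiMatrix K m n) V ≤ ((Fintype.card (m × n) - d : ℕ) : WithBot ℕ∞)) :
    (d : ℕ∞) ≤ codimMatrix V := by
  have h1 : (Fintype.card (m × n) : ℕ∞) ≤ (dimOn (zariskiMatrix K m n) Set.univ).unbotD 0 := by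
    have := card_le_dimOn_zariskiMatrix K m n
    generalize dimOn (zariskiMatrix K m n) Set.univ = a at this
    induction a with
    | bot => exact absurd (le_bot_iff.1 this) (WithBot.natCast_ne_bot _)
    | coe a => rw [WithBot.unbotD_coe]; exact_mod_cast this
  have h2 : (dimOn (zariskiMatrix K m n) V).unbotD 0 ≤ ((Fintype.card (m × n) - d : ℕ) : ℕ∞) := by
    generalize dimOn (zariskiMatrix K m n) V = a at hV
    induction a with
    | bot => simp
    | coe a => exact WithBot.coe_le_coe.1 hV
  refine le_trans ?_ (tsub_le_tsub h1 h2)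
  rw [← ENat.natCast_sub]
  exact_mod_cast (by omega)

/-! ### The matrix varieties -/

/-- This is triangularity up to a reordering by `r`: in a kernel vector, the nonzero coordinate of
largest `r` contributes the only term of its row. -/
theorem det_ne_zero_of_injective_rank {K ι : Type*} [Field K] [Fintype ι] [DecidableEq ι]
    (S : Matrix ι ι K) (r : ι → ℕ) (hr : Function.Injective r) (hdiag : ∀ i, S i i ≠ 0)
    (htri : ∀ i j, r j < r i → S i j = 0) : S.det ≠ 0 := by
  classical
  intro hdet
  obtain ⟨v, hv, hSv⟩ := Matrix.exists_mulVec_eq_zero_iff.2 hdet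
  obtain ⟨i₁, hi₁⟩ := Function.ne_iff.1 hv
  obtain ⟨i, hi, hmax⟩ := Finset.exists_max_image (Finset.univ.filter fun i => v i ≠ 0) r
    ⟨i₁, by simpa using hi₁⟩
  simp only [Finset.mem_filter, Finset.mem_univ, true_and] at hi hmax
  have h := congrFun hSv i
  rw [Matrix.mulVec, dotProduct, Finset.sum_eq_single i] at h
  · exact mul_ne_zero (hdiag i) hi h
  · intro j _ hj
    by_cases hvj : v j = 0
    · rw [hvj, mul_zero]
    · rw [htri i j (lt_of_le_of_ne (hmax j hvj) fun he => hj (hr he)), zero_mul]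
  · simp

section CoreVariety

variable {K : Type*} [Field K] {m N : ℕ}

/-- The `N` columns `α_j + β_j` for `j < κ` and `α_j` for `j > κ`. -/
def hybridColumn (A : Matrix (Fin m) (Fin (N + 1) ⊕ Fin (N + 1)) K) (κ : Fin (N + 1)) (i : Fin N)
    (r : Fin m) : K :=
  if i.castSucc < κ then A r (Sum.inl i.castSucc) + A r (Sum.inr i.castSucc)
  else A r (Sum.inl i.succ)

/-- The polynomial whose value is `hybridColumn`. -/
noncomputable def hybridColumnPoly (K : Type*) [Field K] (κ : Fin (N + 1)) (i : Fin N)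
    (r : Fin m) : MvPolynomial (Fin m × (Fin (N + 1) ⊕ Fin (N + 1))) K :=
  if i.castSucc < κ then X (r, Sum.inl i.castSucc) + X (r, Sum.inr i.castSucc)
  else X (r, Sum.inl i.succ)

theorem familyRank_lt_of_comp {ι κ W : Type*} [Fintype ι] [Finite κ] [AddCommGroup W] [Module K W]
    (w : κ → W) (e : ι → κ) (h : familyRank K w < Fintype.card ι) :
    ¬ LinearIndependent K (w ∘ e) := by
  intro hli
  have := Module.Finite.span_of_finite K (Set.finite_range w)
  have h2 : Module.finrank K (Submodule.span K (Set.range (w ∘ e))) ≤ familyRank K w :=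
    Submodule.finrank_mono (Submodule.span_mono (Set.range_comp_subset_range e w))
  rw [finrank_span_eq_card hli] at h2
  omega

/-- The columns come from the rank condition with `ν = 0` if `κ = 0`, and with `τ = κ - 1`, `ρ = κ`
otherwise, by discarding the one modified vector. -/
theorem not_linearIndependent_hybridColumn
    {A : Matrix (Fin m) (Fin (N + 1) ⊕ Fin (N + 1)) K} (hA : A ∈ coreVariety K m N)
    (κ : Fin (N + 1)) : ¬ LinearIndependent K (hybridColumn A κ) := by
  obtain ⟨-, h1, h2⟩ := hA
  induction κ using Fin.cases with
  | zero =>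
    have h := familyRank_lt_of_comp _ (Fin.succ : Fin N → Fin (N + 1))
      ((h1 0).trans_eq (Fintype.card_fin N).symm)
    refine Eq.subst (motive := fun w => ¬ LinearIndependent K w) ?_ h
    ext i r
    simp [hybridColumn]
  | succ τ =>
    have h := familyRank_lt_of_comp _ (τ.succ.succAbove : Fin N → Fin (N + 1))
      ((h2 τ.castSucc τ.succ Fin.castSucc_lt_succ).trans_eq (Fintype.card_fin N).symm)
    refine Eq.subst (motive := fun w => ¬ LinearIndependent K w) ?_ h
    ext i r
    by_cases hi : i.castSucc < τ.succ
    · have hi' : i.castSucc ≤ τ.castSucc := by simpa [Fin.castSucc_lt_succ_iff] using hi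
      simp only [hybridColumn, hi, if_true, Function.comp, Fin.succAbove_of_castSucc_lt _ _ hi, hi',
        Pi.add_apply]
    · have hi' : ¬ i.succ ≤ τ.castSucc := by
        simp only [Fin.lt_def, Fin.le_def, Fin.val_succ, Fin.val_castSucc] at hi ⊢
        omega
      have hi'' : ¬ i.succ = τ.succ := by
        simp only [Fin.lt_def, Fin.ext_iff, Fin.val_succ, Fin.val_castSucc] at hi ⊢
        omega
      simp only [hybridColumn, hi, if_false, Function.comp,
        Fin.succAbove_of_le_castSucc _ _ (not_lt.1 hi), hi', hi'']

theorem eval_det_hybridColumnPoly (κ : Fin (N + 1)) (ρ : Fin N → Fin m)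
    (x : Fin m × (Fin (N + 1) ⊕ Fin (N + 1)) → K) :
    eval x (Matrix.det (Matrix.of fun i j => hybridColumnPoly K κ j (ρ i))) =
      Matrix.det (Matrix.of fun i j =>
        hybridColumn (Matrix.of fun i j => x (i, j)) κ j (ρ i)) := by
  rw [RingHom.map_det]
  congr 1
  ext i j
  simp only [RingHom.mapMatrix_apply, Matrix.map_apply, Matrix.of_apply, hybridColumnPoly,
    hybridColumn]
  split_ifs <;> simp

theorem isHomogeneous_det_hybridColumnPoly (κ : Fin (N + 1)) (ρ : Fin N → Fin m) :
    (Matrix.det (Matrix.of fun i j => hybridColumnPoly K κ j (ρ i))).IsHomogeneous N := by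
  rw [Matrix.det_apply]
  refine IsHomogeneous.sum _ _ _ fun σ _ => ?_
  have h : (∏ i, Matrix.of (fun i j => hybridColumnPoly K κ j (ρ i)) (σ i) i).IsHomogeneous
      (∑ _i : Fin N, 1) := by
    refine IsHomogeneous.prod _ _ _ fun i _ => ?_
    simp only [Matrix.of_apply, hybridColumnPoly]
    split_ifs
    · exact (isHomogeneous_X _ _).add (isHomogeneous_X _ _)
    · exact isHomogeneous_X _ _
  rw [Finset.sum_const, Finset.card_univ, Fintype.card_fin, smul_eq_mul, mul_one] at h
  rcases Int.units_eq_one_or (Equiv.Perm.sign σ) with hσ | hσ <;> rw [hσ]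
  · simpa using h
  · simpa using h.neg

theorem det_hybridColumn_eq_zero {A : Matrix (Fin m) (Fin (N + 1) ⊕ Fin (N + 1)) K}
    (hA : A ∈ coreVariety K m N) (κ : Fin (N + 1)) (ρ : Fin N → Fin m) :
    Matrix.det (Matrix.of fun i j => hybridColumn A κ j (ρ i)) = 0 := by
  by_contra hdet
  have h := Matrix.linearIndependent_cols_of_det_ne_zero hdet
  exact not_linearIndependent_hybridColumn hA κ
    (LinearIndependent.of_comp (LinearMap.funLeft K K ρ) h)

/-! ### A linear section of the matrix variety -/

/-- The `l`-th band parameter, zero for `l > m`. -/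
noncomputable def bandParam (K : Type*) [Field K] (m l : ℕ) :
    (Fin m ⊕ Fin (m + 1) → K) →ₗ[K] K :=
  if h : l < m + 1 then LinearMap.proj (Sum.inr ⟨l, h⟩) else 0

/-- Entries of the columns `α_j` in the linear section. -/
noncomputable def bandAlpha (K : Type*) [Field K] (m N r j : ℕ) :
    (Fin m ⊕ Fin (m + 1) → K) →ₗ[K] K :=
  if r + N + 1 ≤ j + m then bandParam K m (j + m - N - 1 - r) else 0

/-- Entries of the columns `α_j + β_j` in the linear section. -/
noncomputable def bandGamma (K : Type*) [Field K] (m r j : ℕ) :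
    (Fin m ⊕ Fin (m + 1) → K) →ₗ[K] K :=
  if j ≤ r then bandParam K m (j + m - r) else 0

/-- A linear family of matrices whose columns are shifts of a band of `m + 1` parameters; the `m`
other parameters are the sums of the rows. -/
noncomputable def bandSection (K : Type*) [Field K] (m N : ℕ) :
    (Fin m ⊕ Fin (m + 1) → K) →ₗ[K] (Fin m × (Fin (N + 1) ⊕ Fin (N + 1)) → K) :=
  LinearMap.pi fun p => Sum.elim (fun j : Fin (N + 1) => bandAlpha K m N p.1 j)
    (Fin.snoc (α := fun _ => (Fin m ⊕ Fin (m + 1) → K) →ₗ[K] K)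
      (fun j : Fin N => bandGamma K m p.1 j - bandAlpha K m N p.1 j)
      -- The column `β_N` is in no hybrid column, so it is free to make the row sum equal to the
      -- parameter `Sum.inl`.
      (LinearMap.proj (Sum.inl p.1) - bandAlpha K m N p.1 N - ∑ j : Fin N, bandGamma K m p.1 j))
    p.2

theorem bandSection_rowSum (u : Fin m ⊕ Fin (m + 1) → K) (r : Fin m) :
    ∑ c, bandSection K m N u (r, c) = u (Sum.inl r) := by
  simp only [bandSection, LinearMap.pi_apply, Fintype.sum_sum_type, Sum.elim_inl, Sum.elim_inr]
  rw [Fin.sum_univ_castSucc, Fin.sum_univ_castSucc]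
  simp only [Fin.snoc_castSucc, Fin.snoc_last, LinearMap.sub_apply, LinearMap.proj_apply,
    LinearMap.sum_apply, Finset.sum_sub_distrib, Fin.val_castSucc, Fin.val_last]
  ring

theorem hybridColumn_bandSection (u : Fin m ⊕ Fin (m + 1) → K) (κ : Fin (N + 1)) (i : Fin N)
    (r : Fin m) :
    hybridColumn (Matrix.of fun i j => bandSection K m N u (i, j)) κ i r =
      if (i : ℕ) < κ then bandGamma K m r i u else bandAlpha K m N r (i + 1) u := by
  simp only [hybridColumn, Fin.lt_def, Fin.val_castSucc, Matrix.of_apply, bandSection,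
    LinearMap.pi_apply, Sum.elim_inl, Sum.elim_inr, Fin.snoc_castSucc, LinearMap.sub_apply,
    Fin.val_succ, add_sub_cancel]

theorem exists_minor_ne_zero (hmN : N ≤ m) {u : Fin m ⊕ Fin (m + 1) → K}
    (hu : ∃ l, u (Sum.inr l) ≠ 0) :
    ∃ (κ : Fin (N + 1)) (ρ : Fin N → Fin m), Matrix.det (Matrix.of fun i j =>
      hybridColumn (Matrix.of fun i j => bandSection K m N u (i, j)) κ j (ρ i)) ≠ 0 := by
  classical
  have hex : ∃ k, bandParam K m k u ≠ 0 := by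
    obtain ⟨l, hl⟩ := hu
    refine ⟨l, ?_⟩
    rw [bandParam, dif_pos l.2]
    exact hl
  obtain ⟨k, hk, hmin⟩ : ∃ k, bandParam K m k u ≠ 0 ∧ ∀ l < k, bandParam K m l u = 0 :=
    ⟨Nat.find hex, Nat.find_spec hex, fun l hl => not_not.1 (Nat.find_min hex hl)⟩
  have hkm : k ≤ m := by
    by_contra h
    exact hk (by simp [bandParam, show ¬ k < m + 1 by omega])
  -- The row of the lowest entry `t_k` of column `i`. The `γ` columns use rows from `m - k` on, the
  -- `α` columns rows from `m - N` to `m - k - 1`; `N ≤ m` makes room for them.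
  let r (i : Fin N) : ℕ := if (i : ℕ) < min k N then m + i - k else m + i - N - k
  have hrm : ∀ i, r i < m := by
    intro i
    have := i.2
    simp only [r]
    split_ifs <;> omega
  refine ⟨⟨min k N, by omega⟩, fun i => ⟨r i, hrm i⟩, ?_⟩
  refine det_ne_zero_of_injective_rank _ r ?_ ?_ ?_
  · intro i j hij
    have := i.2
    have := j.2
    simp only [r] at hij
    ext
    split_ifs at hij <;> omega
  · intro i
    have := i.2
    rw [Matrix.of_apply, hybridColumn_bandSection]
    simp only [bandGamma, bandAlpha]
    by_cases hi : (i : ℕ) < min k N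
    · have h1 : r i = m + i - k := if_pos hi
      rw [if_pos hi, h1, if_pos (by omega), show (i : ℕ) + m - (m + i - k) = k by omega]
      exact hk
    · have h1 : r i = m + i - N - k := if_neg hi
      rw [if_neg hi, h1, if_pos (by omega),
        show (i : ℕ) + 1 + m - N - 1 - (m + i - N - k) = k by omega]
      exact hk
  -- Going down a column lowers the parameter index, so below the entry `t_k` only vanishing
  -- parameters occur.
  · intro i j hij
    have := i.2
    have := j.2
    have := hrm i
    rw [Matrix.of_apply, hybridColumn_bandSection]
    simp only [bandGamma, bandAlpha]
    by_cases hj : (j : ℕ) < min k N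
    · have h1 : r j = m + j - k := if_pos hj
      rw [if_pos hj]
      split_ifs with h2
      · exact hmin _ (by omega)
      · rfl
    · have h1 : r j = m + j - N - k := if_neg hj
      rw [if_neg hj]
      split_ifs with h2
      · exact hmin _ (by omega)
      · rfl

theorem zero_mem_coreVariety (hN : 1 ≤ N) :
    (0 : Matrix (Fin m) (Fin (N + 1) ⊕ Fin (N + 1)) K) ∈ coreVariety K m N := by
  have h0 : ∀ w : Fin (N + 1) → (Fin m → K), (∀ j, w j = 0) → familyRank K w + 1 ≤ N := by
    intro w hw
    have : Submodule.span K (Set.range w) = ⊥ := by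
      rw [Submodule.span_eq_bot]
      rintro _ ⟨j, rfl⟩
      exact hw j
    rw [familyRank, this, finrank_bot]
    omega
  refine ⟨?_, fun ν => h0 _ fun j => ?_, fun τ ρ _ => h0 _ fun j => ?_⟩
  · ext i
    simp
  · ext i
    dsimp only
    split_ifs <;> simp
  · ext i
    dsimp only
    split_ifs <;> simp

/-! ### The codimension bound for the matrix varieties. -/

theorem le_codimMatrix_coreVariety [IsAlgClosed K] (hN : 1 ≤ N) (hmN : N ≤ m) :
    ((2 * m + 1 : ℕ) : ℕ∞) ≤ codimMatrix (coreVariety K m N) := by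
  have hcard : Fintype.card (Fin m ⊕ Fin (m + 1)) = 2 * m + 1 := by
    simp only [Fintype.card_sum, Fintype.card_fin]
    ring
  have : Infinite K := IsAlgClosed.instInfinite
  refine le_codimMatrix ?_ ((dimOn_zariskiMatrix_le _).trans ?_)
  · simp only [Fintype.card_prod, Fintype.card_sum, Fintype.card_fin]
    nlinarith
  rw [← hcard]
  refine dimOn_le_of_linear_section ?_ (bandSection K m N) fun u hu => ?_
  · exact zero_mem_coreVariety hN
  by_cases hs : ∃ r, u (Sum.inl r) ≠ 0
  · obtain ⟨r, hr⟩ := hs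
    refine ⟨∑ c, X (r, c), 1, IsHomogeneous.sum _ _ _ fun c _ => isHomogeneous_X _ _,
      fun x hx => ?_, ?_⟩
    · have := congrFun hx.1 r
      simpa [Fintype.sum_sum_type] using this
    · rw [map_sum]
      simpa only [eval_X, bandSection_rowSum] using hr
  · have ht : ∃ l, u (Sum.inr l) ≠ 0 := by
      by_contra! ht
      push Not at hs
      exact hu (funext fun c => by rcases c with r | l <;> simp [hs, ht])
    obtain ⟨κ, ρ, hdet⟩ := exists_minor_ne_zero hmN ht
    refine ⟨_, N, isHomogeneous_det_hybridColumnPoly κ ρ, fun x hx => ?_, ?_⟩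
    · rw [eval_det_hybridColumnPoly]
      exact det_hybridColumn_eq_zero hx κ ρ
    · rw [eval_det_hybridColumnPoly]
      exact hdet

end CoreVariety

/-! ### Dimension and open covers -/

section OpenCover

variable {X Y : Type*} [tX : TopologicalSpace X] [tY : TopologicalSpace Y]

/-- An open set meeting the smallest member of a chain meets all of them, and irreducible closed
sets meeting an open set are determined by their traces on it. -/
theorem dimOn_le_of_open_cover {ι : Type*} {C : Set X} (O : ι → Set X) (hO : ∀ a, IsOpen (O a))
    (hC : C ⊆ ⋃ a, O a) {d : WithBot ℕ∞} (h : ∀ a, dimOn tX (C ∩ O a) ≤ d) : dimOn tX C ≤ d := by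
  refine iSup_le fun p => ?_
  obtain ⟨x, hx⟩ := (p 0).isIrreducible.nonempty
  obtain ⟨a, ha⟩ := Set.mem_iUnion.1 (hC x.2)
  let f : ↥(C ∩ O a) → C := Set.inclusion Set.inter_subset_left
  have hf : IsOpenEmbedding f := by
    refine ⟨IsEmbedding.inclusion _, ?_⟩
    rw [Set.range_inclusion]
    convert (hO a).preimage (continuous_subtype_val (p := (· ∈ C))) using 1
    ext y
    simp
  have hne : ∀ k, (f ⁻¹' (p k : Set C)).Nonempty := fun k =>
    ⟨⟨x.1, x.2, ha⟩, p.monotone (Fin.zero_le k) hx⟩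
  let e := TopologicalSpace.IrreducibleCloseds.orderIsoOfIsOpenEmbedding f hf
  let q : LTSeries (TopologicalSpace.IrreducibleCloseds ↥(C ∩ O a)) :=
    { length := p.length
      toFun := fun k => e.symm ⟨p k, hne k⟩
      step := fun k => e.symm.strictMono (p.step k) }
  exact (Order.LTSeries.length_le_krullDim q).trans (h a)

theorem dimOn_eq_of_invOn {V : Set X} {W : Set Y} {f : X → Y} {g : Y → X}
    (hf : ContinuousOn f V) (hg : ContinuousOn g W) (hfV : Set.MapsTo f V W)
    (hgW : Set.MapsTo g W V) (h : Set.InvOn g f V W) : dimOn tX V = dimOn tY W := by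
  have h1 : Function.LeftInverse (hgW.restrict) (hfV.restrict) := fun x => Subtype.ext (h.1 x.2)
  have h2 : Function.LeftInverse (hfV.restrict) (hgW.restrict) := fun x => Subtype.ext (h.2 x.2)
  have hf' := hf.mapsToRestrict hfV
  have hg' := hg.mapsToRestrict hgW
  exact le_antisymm (IsEmbedding.of_leftInverse h1 hg' hf').isInducing.topologicalKrullDim_le
    (IsEmbedding.of_leftInverse h2 hf' hg').isInducing.topologicalKrullDim_le

end OpenCover

/-! ### The projectivized tangent bundle -/

/-- Clearing denominators turns a polynomial in the chart coordinates into a polynomial in `(z, ξ)`;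
continuity of the charts rests on this. -/
theorem exists_numerator {K σ τ : Type*} [Field K] (D : MvPolynomial τ K)
    (n : σ → MvPolynomial τ K) (f : MvPolynomial σ K) :
    ∃ (g : MvPolynomial τ K) (e : ℕ), ∀ p, eval p D ≠ 0 →
      eval p g = eval p D ^ e * eval (fun s => eval p (n s) / eval p D) f := by
  induction f using MvPolynomial.induction_on with
  | C a => exact ⟨C a, 0, fun p _ => by simp⟩
  | add f₁ f₂ h₁ h₂ =>
    obtain ⟨g₁, e₁, h₁⟩ := h₁
    obtain ⟨g₂, e₂, h₂⟩ := h₂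
    refine ⟨D ^ e₂ * g₁ + D ^ e₁ * g₂, e₁ + e₂, fun p hp => ?_⟩
    simp only [map_add, map_mul, map_pow, h₁ p hp, h₂ p hp]
    ring
  | mul_X f s h =>
    obtain ⟨g, e, h⟩ := h
    refine ⟨g * n s, e + 1, fun p hp => ?_⟩
    simp only [map_mul, eval_X, h p hp, pow_succ]
    field_simp

section Tangent

variable {K : Type*} [Field K] {N : ℕ}

theorem mem_submodule_mk_iff {V : Type*} [AddCommGroup V] [Module K V] {v w : V} {hv : v ≠ 0} :
    w ∈ (Projectivization.mk K v hv).submodule ↔ ∃ a : K, a • v = w := by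
  rw [Projectivization.submodule_mk, Submodule.mem_span_singleton]

theorem rep_mem_submodule {V : Type*} [AddCommGroup V] [Module K V] (x : Projectivization K V) :
    x.rep ∈ x.submodule := by
  rw [Projectivization.submodule_eq]
  exact Submodule.mem_span_singleton_self _

theorem mk_eq_of_mem_submodule {V : Type*} [AddCommGroup V] [Module K V] {v : V} (hv : v ≠ 0)
    {x : Projectivization K V} (h : v ∈ x.submodule) : Projectivization.mk K v hv = x := by
  induction x using Projectivization.ind with
  | h w hw => exact (Projectivization.mk_eq_mk_iff' K _ _ _ _).2 (mem_submodule_mk_iff.1 h)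

theorem mem_tangentProj_fst {p : TangentPair K N} {z : Fin (N + 1) → K} :
    z ∈ (tangentProj K N p).1.submodule ↔ ∃ a : K, a • p.1.1 = z :=
  mem_submodule_mk_iff

theorem mem_tangentProj_snd {p : TangentPair K N} {ξ : Fin (N + 1) → K} :
    Submodule.Quotient.mk ξ ∈ (tangentProj K N p).2.submodule ↔
      ∃ b c : K, ξ = b • p.1.2 + c • p.1.1 := by
  refine mem_submodule_mk_iff.trans (exists_congr fun b => ?_)
  refine Iff.trans (b := b • p.1.2 - ξ ∈ (Projectivization.mk K p.1.1 p.2.1).submodule)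
    (Submodule.Quotient.eq _) (mem_submodule_mk_iff.trans ⟨?_, ?_⟩)
  · rintro ⟨c, hc⟩
    exact ⟨-c, by rw [neg_smul, hc]; abel⟩
  · rintro ⟨c, hc⟩
    exact ⟨-c, by rw [neg_smul, hc]; abel⟩

theorem tangentProj_eq_of_mem {q : ProjTangent K N} {p : TangentPair K N}
    (h1 : p.1.1 ∈ q.1.submodule) (h2 : Submodule.Quotient.mk p.1.2 ∈ q.2.submodule) :
    tangentProj K N p = q := by
  obtain ⟨x, y⟩ := q
  obtain rfl := mk_eq_of_mem_submodule p.2.1 h1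
  rw [tangentProj]
  congr 1
  exact mk_eq_of_mem_submodule _ h2

theorem tangentProj_surjective : Function.Surjective (tangentProj K N) := by
  rintro ⟨x, y⟩
  obtain ⟨ξ, hξ⟩ := Submodule.Quotient.mk_surjective _ y.rep
  refine ⟨⟨(x.rep, ξ), x.rep_nonzero, ?_⟩, tangentProj_eq_of_mem (rep_mem_submodule x) ?_⟩
  · rw [← Projectivization.submodule_eq, ← Submodule.Quotient.mk_eq_zero, hξ]
    exact y.rep_nonzero
  · exact hξ.symm ▸ rep_mem_submodule y

theorem tangentProj_eq_iff {p p' : TangentPair K N} :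
    tangentProj K N p = tangentProj K N p' ↔
      ∃ a b c : K, p'.1.1 = a • p.1.1 ∧ p'.1.2 = b • p.1.2 + c • p.1.1 := by
  constructor
  · intro h
    have h1 : p'.1.1 ∈ (tangentProj K N p).1.submodule := by
      rw [h]
      exact mem_tangentProj_fst.2 ⟨1, one_smul _ _⟩
    have h2 : Submodule.Quotient.mk p'.1.2 ∈ (tangentProj K N p).2.submodule := by
      rw [h]
      exact mem_tangentProj_snd.2 ⟨1, 0, by simp⟩
    obtain ⟨a, ha⟩ := mem_tangentProj_fst.1 h1
    obtain ⟨b, c, hbc⟩ := mem_tangentProj_snd.1 h2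
    exact ⟨a, b, c, ha.symm, hbc⟩
  · rintro ⟨a, b, c, h1, h2⟩
    exact (tangentProj_eq_of_mem (mem_tangentProj_fst.2 ⟨a, h1.symm⟩)
      (mem_tangentProj_snd.2 ⟨b, c, h2⟩)).symm

theorem tangentProj_mem_coordinateStratum {p : TangentPair K N} {S : Set (Fin (N + 1))} :
    tangentProj K N p ∈ coordinateStratum K N S ↔ ∀ k, p.1.1 k = 0 ↔ k ∈ S := by
  obtain ⟨a, ha⟩ := Projectivization.exists_smul_eq_mk_rep K p.1.1 p.2.1
  refine forall_congr' fun k => ?_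
  have : (tangentProj K N p).1.rep = a • p.1.1 := ha.symm
  rw [this]
  simp [Units.smul_def]

/-! ### Open sets and affine charts of the projectivized tangent bundle. -/

theorem isOpen_zariskiProjTangent {s : Set (ProjTangent K N)}
    (P : MvPolynomial (Fin (N + 1) ⊕ Fin (N + 1)) K)
    (h : ∀ p : TangentPair K N, tangentProj K N p ∈ s ↔ eval (Sum.elim p.1.1 p.1.2) P ≠ 0) :
    IsOpen[zariskiProjTangent K N] s := by
  let _ := zariskiAffine K (Fin (N + 1) ⊕ Fin (N + 1))
  refine isOpen_coinduced.2 (isOpen_induced_iff.2 ⟨_, isOpen_zariskiAffine_ne P, ?_⟩)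
  ext p
  exact (h p).symm

/-- The polynomial `ξ_k z_i - ξ_i z_k`. -/
noncomputable def tangentMinor (K : Type*) [Field K] {N : ℕ} (i k : Fin (N + 1)) :
    MvPolynomial (Fin (N + 1) ⊕ Fin (N + 1)) K :=
  X (Sum.inr k) * X (Sum.inl i) - X (Sum.inr i) * X (Sum.inl k)

/-- The indices of the affine coordinates on the chart `z_i = 1`, `ξ_i = 0`, `ξ_j = 1` of the
stratum where exactly the `z_k` with `k ∈ S` vanish. -/
abbrev ChartIndex {N : ℕ} (S : Set (Fin (N + 1))) (i j : Fin (N + 1)) : Type :=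
  {k : Fin (N + 1) // k ≠ i ∧ k ∉ S} ⊕ {k : Fin (N + 1) // k ≠ i ∧ k ≠ j}

/-- The affine coordinates of a tangent vector. -/
def chartOfPair (S : Set (Fin (N + 1))) (i j : Fin (N + 1)) (p : TangentPair K N) :
    ChartIndex S i j → K :=
  Sum.elim (fun k => p.1.1 k / p.1.1 i) fun k =>
    (p.1.2 k * p.1.1 i - p.1.2 i * p.1.1 k) / (p.1.2 j * p.1.1 i - p.1.2 i * p.1.1 j)

/-- The affine coordinates on the projectivized tangent bundle. -/
noncomputable def chart (S : Set (Fin (N + 1))) (i j : Fin (N + 1)) (q : ProjTangent K N) :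
    ChartIndex S i j → K :=
  chartOfPair S i j (Function.surjInv tangentProj_surjective q)

theorem chart_tangentProj (S : Set (Fin (N + 1))) (i j : Fin (N + 1)) (p : TangentPair K N) :
    chart S i j (tangentProj K N p) = chartOfPair S i j p := by
  obtain ⟨a, b, c, h1, h2⟩ := tangentProj_eq_iff.1
    (Function.surjInv_eq tangentProj_surjective (tangentProj K N p)).symm
  rw [chart]
  generalize Function.surjInv tangentProj_surjective (tangentProj K N p) = p' at h1 h2
  have ha : a ≠ 0 := by
    rintro rfl
    exact p'.2.1 (by simpa using h1)
  have hb : b ≠ 0 := by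
    rintro rfl
    refine p'.2.2 (Submodule.mem_span_singleton.2 ⟨c * a⁻¹, ?_⟩)
    rw [h1, h2, smul_smul, inv_mul_cancel_right₀ ha, zero_smul, zero_add]
  -- The minors of `(z, ξ)` scale by `a * b` under a change of representative, so their quotients
  -- are well defined.
  have h3 : ∀ i k, p'.1.2 k * p'.1.1 i - p'.1.2 i * p'.1.1 k =
      (a * b) * (p.1.2 k * p.1.1 i - p.1.2 i * p.1.1 k) := by
    intro i k
    simp only [h1, h2, Pi.add_apply, Pi.smul_apply, smul_eq_mul]
    ring
  ext k
  rcases k with k | k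
  · simp only [chartOfPair, Sum.elim_inl, h1, Pi.smul_apply, smul_eq_mul]
    exact mul_div_mul_left _ _ ha
  · simp only [chartOfPair, Sum.elim_inr, h3]
    exact mul_div_mul_left _ _ (mul_ne_zero ha hb)

/-- The open part of the projectivized tangent bundle where `z_i ≠ 0` and
`ξ_j z_i - ξ_i z_j ≠ 0`. -/
def chartDomain (K : Type*) [Field K] {N : ℕ} (i j : Fin (N + 1)) : Set (ProjTangent K N) :=
  {q | ∀ p, tangentProj K N p = q →
    p.1.1 i ≠ 0 ∧ p.1.2 j * p.1.1 i - p.1.2 i * p.1.1 j ≠ 0}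

theorem tangentProj_mem_chartDomain {i j : Fin (N + 1)} {p : TangentPair K N} :
    tangentProj K N p ∈ chartDomain K i j ↔
      p.1.1 i ≠ 0 ∧ p.1.2 j * p.1.1 i - p.1.2 i * p.1.1 j ≠ 0 := by
  refine ⟨fun h => h p rfl, fun h p' hp' => ?_⟩
  obtain ⟨a, b, c, h1, h2⟩ := tangentProj_eq_iff.1 hp'
  simp only [h1, h2, Pi.add_apply, Pi.smul_apply, smul_eq_mul] at h
  refine ⟨right_ne_zero_of_mul h.1, fun h0 => h.2 ?_⟩
  linear_combination (a * b) * h0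

theorem isOpen_chartDomain (i j : Fin (N + 1)) :
    IsOpen[zariskiProjTangent K N] (chartDomain K i j) :=
  isOpen_zariskiProjTangent (X (Sum.inl i) * tangentMinor K i j) fun p => by
    simp [tangentProj_mem_chartDomain, tangentMinor]

theorem isOpen_chart_ne (S : Set (Fin (N + 1))) (i j : Fin (N + 1))
    (f : MvPolynomial (ChartIndex S i j) K) :
    IsOpen[zariskiProjTangent K N] {q | q ∈ chartDomain K i j ∧ eval (chart S i j q) f ≠ 0} := by
  let D := X (Sum.inl i) * tangentMinor K i j
  obtain ⟨g, e, hg⟩ := exists_numerator D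
    (Sum.elim (fun k => X (Sum.inl k.1) * tangentMinor K i j)
      (fun k => X (Sum.inl i) * tangentMinor K i k.1) :
        ChartIndex S i j → MvPolynomial (Fin (N + 1) ⊕ Fin (N + 1)) K) f
  -- The factor `D` confines the set to the chart domain, where `g` vanishes exactly when `f` does.
  refine isOpen_zariskiProjTangent (D * g) fun p => ?_
  have hD : eval (Sum.elim p.1.1 p.1.2) D ≠ 0 ↔ tangentProj K N p ∈ chartDomain K i j := by
    simp [tangentProj_mem_chartDomain, tangentMinor, D]
  rw [Set.mem_ofPred_eq, map_mul, mul_ne_zero_iff, hD]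
  refine and_congr_right fun hp => ?_
  rw [hg _ (hD.2 hp), chart_tangentProj, mul_ne_zero_iff, and_iff_right (pow_ne_zero _ (hD.2 hp))]
  rw [tangentProj_mem_chartDomain] at hp
  have : (fun s => eval (Sum.elim p.1.1 p.1.2)
      ((Sum.elim (fun k => X (Sum.inl k.1) * tangentMinor K i j)
      (fun k => X (Sum.inl i) * tangentMinor K i k.1) :
        ChartIndex S i j → MvPolynomial (Fin (N + 1) ⊕ Fin (N + 1)) K) s) /
      eval (Sum.elim p.1.1 p.1.2) D) = chartOfPair S i j p := by
    ext k
    rcases k with k | k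
    · simp only [chartOfPair, D, tangentMinor, Sum.elim_inl, Sum.elim_inr, map_mul, map_sub, eval_X]
      exact mul_div_mul_right _ _ hp.2
    · simp only [chartOfPair, D, tangentMinor, Sum.elim_inl, Sum.elim_inr, map_mul, map_sub, eval_X]
      exact mul_div_mul_left _ _ hp.1
  rw [this]

theorem continuousOn_chart (S : Set (Fin (N + 1))) (i j : Fin (N + 1)) :
    @ContinuousOn _ _ (zariskiProjTangent K N) (zariskiAffine K (ChartIndex S i j))
      (chart S i j) (chartDomain K i j) := by
  let _ := zariskiProjTangent K N
  let _ := zariskiAffine K (ChartIndex S i j)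
  rw [(isOpen_chartDomain i j).continuousOn_iff]
  intro q hq
  refine continuousAt_def.2 fun A hA => ?_
  obtain ⟨U, hUA, hU, hqU⟩ := mem_nhds_iff.1 hA
  obtain ⟨f, hf, hfU⟩ := exists_eval_ne_zero_of_isOpen hU hqU
  exact mem_nhds_iff.2 ⟨_, fun q' hq' => hUA (hfU _ hq'.2), isOpen_chart_ne S i j f, hq, hf⟩

/-- The tangent vector with given affine coordinates. -/
noncomputable def pairOfChart (S : Set (Fin (N + 1))) {i j : Fin (N + 1)} (hij : j ≠ i)
    (x : ChartIndex S i j → K) : TangentPair K N :=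
  open Classical in
  ⟨(fun k => if hi : k = i then 1 else if hS : k ∈ S then 0 else x (Sum.inl ⟨k, hi, hS⟩),
    fun k => if hi : k = i then 0 else if hj : k = j then 1 else x (Sum.inr ⟨k, hi, hj⟩)), by
    constructor
    · intro h
      simpa using congrFun h i
    · intro h
      obtain ⟨c, hc⟩ := Submodule.mem_span_singleton.1 h
      have h1 := congrFun hc i
      have h2 := congrFun hc j
      simp only [Pi.smul_apply, dite_true, smul_eq_mul, mul_one] at h1
      simp [h1, hij] at h2⟩

theorem continuous_pairOfChart (S : Set (Fin (N + 1))) {i j : Fin (N + 1)} (hij : j ≠ i) :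
    Continuous[zariskiAffine K (ChartIndex S i j), zariskiProjTangent K N]
      fun x => tangentProj K N (pairOfChart S hij x) := by
  classical
  let _ := zariskiAffine K (ChartIndex S i j)
  let _ := zariskiAffine K (Fin (N + 1) ⊕ Fin (N + 1))
  let t := (zariskiAffine K (Fin (N + 1) ⊕ Fin (N + 1))).induced
    fun p : TangentPair K N => Sum.elim p.1.1 p.1.2
  refine @Continuous.comp _ _ _ (zariskiAffine K (ChartIndex S i j)) t (zariskiProjTangent K N)
    (pairOfChart S hij) (tangentProj K N) continuous_coinduced_rng (continuous_induced_rng.2 ?_)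
  have := continuous_zariskiAffine (K := K) (Sum.elim
    (fun k => if hi : k = i then 1 else if hS : k ∈ S then 0 else X (Sum.inl ⟨k, hi, hS⟩))
    (fun k => if hi : k = i then 0 else if hj : k = j then 1 else X (Sum.inr ⟨k, hi, hj⟩)) :
    Fin (N + 1) ⊕ Fin (N + 1) → MvPolynomial (ChartIndex S i j) K)
  convert this using 1
  ext x k
  rcases k with k | k <;> simp only [Function.comp, pairOfChart, Sum.elim_inl, Sum.elim_inr] <;>
    split_ifs <;> simp

theorem chart_pairOfChart (S : Set (Fin (N + 1))) {i j : Fin (N + 1)} (hij : j ≠ i)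
    (x : ChartIndex S i j → K) : chart S i j (tangentProj K N (pairOfChart S hij x)) = x := by
  rw [chart_tangentProj]
  ext k
  rcases k with ⟨k, hk⟩ | ⟨k, hk⟩ <;> simp [chartOfPair, pairOfChart, hk, hij]

theorem pairOfChart_mem_chartDomain (S : Set (Fin (N + 1))) {i j : Fin (N + 1)} (hij : j ≠ i)
    (x : ChartIndex S i j → K) :
    tangentProj K N (pairOfChart S hij x) ∈ chartDomain K i j := by
  rw [tangentProj_mem_chartDomain]
  simp [pairOfChart, hij]

theorem pairOfChart_mem_coordinateStratum {S : Set (Fin (N + 1))} {i j : Fin (N + 1)} (hij : j ≠ i)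
    (hi : i ∉ S) {x : ChartIndex S i j → K} (hx : ∀ k, x (Sum.inl k) ≠ 0) :
    tangentProj K N (pairOfChart S hij x) ∈ coordinateStratum K N S := by
  rw [tangentProj_mem_coordinateStratum]
  intro k
  simp only [pairOfChart]
  split_ifs with h1 h2
  · simp [h1, hi]
  · simp [h2]
  · simp [h2, hx]

theorem pairOfChart_chart {S : Set (Fin (N + 1))} {i j : Fin (N + 1)} (hij : j ≠ i)
    {q : ProjTangent K N} (hS : q ∈ coordinateStratum K N S) (hq : q ∈ chartDomain K i j) :
    tangentProj K N (pairOfChart S hij (chart S i j q)) = q := by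
  obtain ⟨p, rfl⟩ := tangentProj_surjective q
  rw [chart_tangentProj, eq_comm, tangentProj_eq_iff]
  rw [tangentProj_mem_chartDomain] at hq
  rw [tangentProj_mem_coordinateStratum] at hS
  obtain ⟨h1, h2⟩ := hq
  set Δ := p.1.2 j * p.1.1 i - p.1.2 i * p.1.1 j with hΔ
  -- Rescaling makes `z_i = 1`; subtracting a multiple of `z` makes `ξ_i = 0`, and division by `Δ`
  -- makes `ξ_j = 1`.
  refine ⟨(p.1.1 i)⁻¹, p.1.1 i / Δ, - p.1.2 i / Δ, ?_, ?_⟩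
  · ext k
    simp only [pairOfChart, chartOfPair, Sum.elim_inl, Pi.smul_apply, smul_eq_mul]
    split_ifs with h3 h4
    · rw [h3, inv_mul_cancel₀ h1]
    · rw [(hS k).2 h4, mul_zero]
    · rw [div_eq_inv_mul]
  · ext k
    simp only [pairOfChart, chartOfPair, Sum.elim_inr, Pi.smul_apply, Pi.add_apply, smul_eq_mul]
    split_ifs with h3 h4
    · rw [h3]
      ring
    · rw [h4]
      field_simp
      rw [hΔ]
      ring
    · rw [← hΔ]
      ring

variable [Infinite K]

theorem dimOn_coordinateStratum_inter_chartDomain {S : Set (Fin (N + 1))} {i j : Fin (N + 1)}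
    (hij : j ≠ i) (hi : i ∉ S) :
    dimOn (zariskiProjTangent K N) (coordinateStratum K N S ∩ chartDomain K i j) =
      Nat.card (ChartIndex S i j) := by
  classical
  let _ := zariskiProjTangent K N
  let _ := zariskiAffine K (ChartIndex S i j)
  let U : Set (ChartIndex S i j → K) := {x | ∀ k, x (Sum.inl k) ≠ 0}
  have hU : IsOpen U := by
    have : U = {x | eval x (∏ k, X (Sum.inl k)) ≠ 0} := by
      ext x
      simp [U, map_prod, Finset.prod_ne_zero_iff]
    rw [this]
    exact isOpen_zariskiAffine_ne _
  rw [dimOn_eq_of_invOn (V := coordinateStratum K N S ∩ chartDomain K i j) (W := U)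
    (f := chart S i j) (g := fun x => tangentProj K N (pairOfChart S hij x))
    ((continuousOn_chart S i j).mono Set.inter_subset_right)
    (continuous_pairOfChart S hij).continuousOn ?_ ?_ ⟨?_, ?_⟩, Nat.card_eq_fintype_card]
  · exact le_antisymm (dimOn_affine_le _) (card_le_dimOn_of_isOpen hU ⟨fun _ => 1, by simp [U]⟩)
  · rintro q ⟨hq, hq'⟩ k
    obtain ⟨p, rfl⟩ := tangentProj_surjective q
    rw [tangentProj_mem_coordinateStratum] at hq
    rw [tangentProj_mem_chartDomain] at hq'
    rw [chart_tangentProj]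
    exact div_ne_zero (fun h => k.2.2 ((hq _).1 h)) hq'.1
  · exact fun x hx => ⟨pairOfChart_mem_coordinateStratum hij hi hx,
      pairOfChart_mem_chartDomain S hij x⟩
  · exact fun q hq => pairOfChart_chart hij hq.1 hq.2
  · exact fun x _ => chart_pairOfChart S hij x

theorem card_chartIndex {S : Set (Fin (N + 1))} {i j : Fin (N + 1)} (hij : j ≠ i) (hi : i ∉ S) :
    Nat.card (ChartIndex S i j) = 2 * N - S.ncard - 1 := by
  have h1 : Nat.card {k : Fin (N + 1) // k ≠ i ∧ k ∉ S} = N - S.ncard := by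
    have : {k : Fin (N + 1) | k ≠ i ∧ k ∉ S} = (insert i S)ᶜ := by
      ext k
      simp
    change Nat.card {k : Fin (N + 1) | k ≠ i ∧ k ∉ S} = _
    rw [this, Nat.card_coe_set_eq, Set.ncard_compl, Set.ncard_insert_of_notMem hi,
      Nat.card_eq_fintype_card, Fintype.card_fin]
    omega
  have h2 : Nat.card {k : Fin (N + 1) // k ≠ i ∧ k ≠ j} = N - 1 := by
    have : {k : Fin (N + 1) | k ≠ i ∧ k ≠ j} = {i, j}ᶜ := by
      ext k
      simp
    change Nat.card {k : Fin (N + 1) | k ≠ i ∧ k ≠ j} = _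
    rw [this, Nat.card_coe_set_eq, Set.ncard_compl, Set.ncard_pair hij.symm,
      Nat.card_eq_fintype_card, Fintype.card_fin]
    omega
  have h3 : S.ncard ≤ N := by
    have := Set.ncard_le_card (insert i S)
    rw [Set.ncard_insert_of_notMem hi, Nat.card_eq_fintype_card, Fintype.card_fin] at this
    omega
  have h4 : 1 ≤ N := by
    have := i.2
    have := j.2
    by_contra h
    exact hij (Fin.ext (by omega))
  rw [Nat.card_sum, h1, h2]
  omega

/-- For a fixed `i ∉ S`, `z_i` is nonzero on the whole stratum, and `ξ ∉ K·z` makes some minor with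
`j ≠ i` nonzero. The charts with this `i` thus cover the stratum, all with the same dimension. -/
theorem dimStratum_eq (hN : 1 ≤ N) {S : Set (Fin (N + 1))} (hS : S.ncard ≤ N) :
    dimStratum K N S = ((2 * N - S.ncard - 1 : ℕ) : WithBot ℕ∞) := by
  let _ := zariskiProjTangent K N
  obtain ⟨i, hi⟩ : ∃ i, i ∉ S := by
    by_contra! h
    rw [Set.eq_univ_of_forall h, Set.ncard_univ, Nat.card_eq_fintype_card, Fintype.card_fin] at hS
    omega
  have hdim : ∀ j, j ≠ i → dimOn (zariskiProjTangent K N)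
      (coordinateStratum K N S ∩ chartDomain K i j) = ((2 * N - S.ncard - 1 : ℕ) : WithBot ℕ∞) :=
    fun j hij => by rw [dimOn_coordinateStratum_inter_chartDomain hij hi, card_chartIndex hij hi]
  refine le_antisymm ?_ ?_
  · refine dimOn_le_of_open_cover (ι := {j // j ≠ i}) (fun j => chartDomain K i j)
      (fun j => isOpen_chartDomain i j) (fun q hq => ?_) fun j => (hdim j j.2).le
    obtain ⟨p, rfl⟩ := tangentProj_surjective q
    rw [tangentProj_mem_coordinateStratum] at hq
    have hpi : p.1.1 i ≠ 0 := fun h => hi ((hq i).1 h)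
    obtain ⟨j, hj⟩ : ∃ j, p.1.2 j * p.1.1 i - p.1.2 i * p.1.1 j ≠ 0 := by
      by_contra! h
      refine p.2.2 (Submodule.mem_span_singleton.2 ⟨p.1.2 i / p.1.1 i, ?_⟩)
      ext k
      rw [Pi.smul_apply, smul_eq_mul]
      field_simp
      linear_combination -h k
    refine Set.mem_iUnion.2 ⟨⟨j, ?_⟩, tangentProj_mem_chartDomain.2 ⟨hpi, hj⟩⟩
    rintro rfl
    exact hj (sub_self _)
  · have : Nontrivial (Fin (N + 1)) := Fin.nontrivial_iff_two_le.2 (by omega)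
    obtain ⟨j, hij⟩ := exists_ne i
    rw [← hdim j hij]
    exact dimOn_mono Set.inter_subset_left

end Tangent

end MovingCoefficients

theorem mainTheorem5 {K : Type*} [Field K] [IsAlgClosed K] (N c r : ℕ) (hN : 1 ≤ N)
    (hcr : N ≤ 2 * c + r) :
    (MovingCoefficients.dimStratum K N ∅
        ≤ (MovingCoefficients.codimMatrix
            (MovingCoefficients.coreVariety K (2 * c + r) N) : WithBot ℕ∞) ∧
      MovingCoefficients.dimStratum K N ∅ = ((2 * N - 1 : ℕ) : WithBot ℕ∞)) ∧
    ∀ η : ℕ, 1 ≤ η → η + (c + r) + 1 ≤ N → ∀ v : Fin η → Fin (N + 1), StrictMono v →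
      MovingCoefficients.dimStratum K N (Set.range v)
        ≤ (MovingCoefficients.codimMatrix
            (MovingCoefficients.coreVariety K (2 * c + r) (N - η)) : WithBot ℕ∞) ∧
      MovingCoefficients.dimStratum K N (Set.range v)
        = ((2 * N - η - 1 : ℕ) : WithBot ℕ∞) := by
  have : Infinite K := IsAlgClosed.instInfinite
  -- The codimension bound depends only on the number of rows, so one statement serves both `N` and
  -- `N - η`.
  have key : ∀ (n d : ℕ), 1 ≤ n → n ≤ 2 * c + r → d ≤ 2 * (2 * c + r) + 1 →
      ((d : ℕ) : WithBot ℕ∞) ≤ (MovingCoefficients.codimMatrix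
        (MovingCoefficients.coreVariety K (2 * c + r) n) : WithBot ℕ∞) := by
    intro n d hn hnm hd
    have h := MovingCoefficients.le_codimMatrix_coreVariety (K := K) hn hnm
    have hd' : (d : ℕ∞) ≤ ((2 * (2 * c + r) + 1 : ℕ) : ℕ∞) := by exact_mod_cast hd
    exact WithBot.coe_le_coe.2 (hd'.trans h)
  refine ⟨?_, fun η h1 h2 v hv => ?_⟩
  · have h := MovingCoefficients.dimStratum_eq (K := K) hN (S := ∅) (by simp)
    rw [Set.ncard_empty, Nat.sub_zero] at h
    refine ⟨?_, h⟩
    rw [h]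
    exact key _ _ hN hcr (by omega)
  · have hη : (Set.range v).ncard = η := by
      rw [← Set.image_univ, Set.ncard_image_of_injective _ hv.injective, Set.ncard_univ,
        Nat.card_eq_fintype_card, Fintype.card_fin]
    have h := MovingCoefficients.dimStratum_eq (K := K) hN (S := Set.range v) (by omega)
    rw [hη] at h
    refine ⟨?_, h⟩
    rw [h]
    exact key _ _ (by omega) (by omega) (by omega)
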